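/- **Setting.** For a set $S\subseteq\{0,1,*\}^n$ of partial assignments (certificates), let $f_S$ be the relation with output alphabet $S$ in which $x\in\{0,1\}^n$ is related to every $c\in S$ consistent with $x$, i.e. agreeing with $x$ on the non-$*$ positions of $c$; $f_S(x)$ is the set of these $c$. A *query TFNP problem* is a family $f=(f_{S_i})_{i\in\mathbb N}$, with $S_i\subseteq\{0,1,*\}^{n_i}$, such that $n_0<n_1<\cdots$, every $f_{S_i}$ is total ($f_{S_i}(x)\neq\emptyset$ for all $x$), and the largest number of non-$*$ positions of a certificate in $S_i$ is $O((\log n_i)^k)$ for some $k\in\mathbb N$. For a relation $f\subseteq\{0,1\}^n\times\Sigma$, $\Sigma$ finite, $\mathrm{adeg}_\varepsilon(f)$ is the least $d$ for which there are real $n$-variate polynomials $(p_c)_{c\in\Sigma}$ of degree at most $d$ with $p_c(x)\ge 0$ and $\sum_{c\in\Sigma}p_c(x)\le 1$ for all $c$ and all $x\in\{0,1\}^n$, and $\sum_{c\in f(x)}p_c(x)\ge 1-\varepsilon$ for all $x$ with $f(x)\ne\emptyset$. For a distribution $\mu$ on $\{0,1\}^n$, $\mathrm{adeg}_\varepsilon(f,\mu)$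 is defined in the same way, with the last condition replaced by $\sum_{x:f(x)\neq\emptyset}\mu(x)\sum_{c\in f(x)}p_c(x)\ge 1-\varepsilon$. For a real matrix $P$, $\gamma_2(P)=\inf_{BC=P}\|B\|_r\|C\|_c$, where $\|B\|_r$ is the largest Euclidean norm of a row of $B$ and $\|C\|_c$ the largest Euclidean norm of a column of $C$. For a communication relation $F\subseteq\mathcal X\times\mathcal Y\times\Sigma$, $\tilde\gamma_{2,\varepsilon}(F)$ is the infimum of $\max_{c}\gamma_2(P_c)$ over the systems of real $\mathcal X\times\mathcal Y$ matrices $(P_c)_{c\in\Sigma}$ with $P_c(x,y)\ge0$ and $\sum_{c\in\Sigma}P_c(x,y)\le1$ for all $c,x,y$, and $\sum_{c\in F(x,y)}P_c(x,y)\ge1-\varepsilon$ for all $(x,y)$ with $F(x,y)\neq\emptyset$; for a distribution $M$ on $\mathcal X\times\mathcal Y$, $\tilde\gamma_{2,\varepsilon}(F,M)$ is defined in the same way, with the last condition replaced by $\sum_{(x,y):F(x,y)\ne\emptyset}M(x,y)\sum_{c\in F(x,y)}P_c(x,y)\ge1-\varepsilon$. (The infimum over the empty set is $+\infty$.) Let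 $G(x_1,x_2,y_1,y_2)=x_1\oplus y_1\oplus(x_2\wedge y_2)$, and let $G^n:\{0,1\}^{2n}\times\{0,1\}^{2n}\to\{0,1\}^n$ apply $G$ in each of $n$ blocks of two bits. **Theorem.** 1. For every $n$ and every probability distribution $\mu$ on $\{0,1\}^n$, $2^{-3n}\,\mu\circ G^n$ is a probability distribution on $\{0,1\}^{2n}\times\{0,1\}^{2n}$. Moreover, there is a universal constant $C>0$ such that the following two statements hold. 2. (Distributional version.) Let $f=(f_i)_i$ be a query TFNP problem with $f_i$ on $n_i$ bits, let $\mu_i$ be a probability distribution on $\{0,1\}^{n_i}$, and let $0<\delta_i\le1$. Suppose that $(\log n_i)^k=o(\mathrm{adeg}_{1-\delta_i}(f_i,\mu_i))$ as $i\to\infty$ for every $k\in\mathbb N$, and that $\delta_i>2^{-\mathrm{adeg}_{1-\delta_i}(f_i)/3}$ for all $i$. Then, with $M_i=2^{-3n_i}\mu_i\circ G^{n_i}$, for all sufficiently large $i$, $$\log\tilde\gamma_{2,1-2\delta_i}(f_i\circ G^{n_i},M_i)\ \ge\ C\cdot\mathrm{adeg}_{1-\delta_i}(f_i,\mu_i).$$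 3. (Worst-case version.) Let $f=(f_i)_i$ be a query TFNP problem with $f_i$ on $n_i$ bits, and let $0<\delta_i\le1$. Suppose that $(\log n_i)^k=o(\mathrm{adeg}_{1-\delta_i}(f_i))$ as $i\to\infty$ for every $k\in\mathbb N$, and that $\delta_i>2^{-\mathrm{adeg}_{1-\delta_i}(f_i)/3}$ for all $i$. Then, for all sufficiently large $i$, $$\log\tilde\gamma_{2,1-2\delta_i}(f_i\circ G^{n_i})\ \ge\ C\cdot\mathrm{adeg}_{1-\delta_i}(f_i).$$ -/

import Mathlib

open Filter Asymptotics
open scoped ENNReal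

namespace TotalSearch

/-! ### Relations and search problems -/

/-- Bit strings of length `n`; `true` is the bit 1. -/
abbrev Bits (n : ℕ) : Type := Fin n → Bool

/-- A query relation on `n` bits with output alphabet `A`: the set of allowed outputs of each
input. -/
abbrev QueryRel (n : ℕ) (A : Type*) := Bits n → Finset A

/-- A partial assignment on `n` bits; `none` is the symbol `*`. -/
abbrev PartialAssignment (n : ℕ) : Type := Fin n → Option Bool

/-- The number of non-`*` positions of a partial assignment. -/
def PartialAssignment.size {n : ℕ} (c : PartialAssignment n) : ℕ :=
  (Finset.univ.filter fun i => c i ≠ none).card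

/-- The partial assignment `c` is consistent with the string `x`. -/
def PartialAssignment.Consistent {n : ℕ} (c : PartialAssignment n) (x : Bits n) : Prop :=
  ∀ i, c i = none ∨ c i = some (x i)

instance {n : ℕ} (c : PartialAssignment n) (x : Bits n) : Decidable (c.Consistent x) :=
  inferInstanceAs (Decidable (∀ i, c i = none ∨ c i = some (x i)))

/-- The certifying cost of a search problem `S`, the largest size of a certificate in `S`. -/
def certCost {n : ℕ} (S : Finset (PartialAssignment n)) : ℕ :=
  S.sup fun c => c.size

/-- The relation of the search problem `S`: on input `x`, output a certificate `c ∈ S` that is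
consistent with `x`. The output alphabet is `S` itself. -/
def searchRel {n : ℕ} (S : Finset (PartialAssignment n)) : QueryRel n S :=
  fun x => Finset.univ.filter fun c : S => c.1.Consistent x

/-- A query TFNP problem: a family of total search problems, the `i`-th one on `n i` bits, whose
certificates have polylogarithmic size. -/
structure IsQueryTFNP (n : ℕ → ℕ) (S : ∀ i, Finset (PartialAssignment (n i))) : Prop where
  strictMono : StrictMono n
  total : ∀ i x, (searchRel (S i) x).Nonempty
  polylog_cert : ∃ k : ℕ,
    (fun i => (certCost (S i) : ℝ)) =O[atTop] fun i => Real.log (n i) ^ k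

/-! ### Approximate degree of relations -/

/-- The value of a real polynomial in `n` variables at a bit string. -/
noncomputable def evalBits {n : ℕ} (p : MvPolynomial (Fin n) ℝ) (x : Bits n) : ℝ :=
  MvPolynomial.eval (fun i => if x i then (1 : ℝ) else 0) p

section Degree

variable {n : ℕ} {A : Type*} [Fintype A]

/-- The degree of a collection of polynomials, the maximum of their degrees. -/
noncomputable def systemDegree (p : A → MvPolynomial (Fin n) ℝ) : ℕ :=
  Finset.univ.sup fun s => (p s).totalDegree

/-- On all inputs the values of the polynomials are nonnegative and sum to at most 1. -/
def PolyBounded (p : A → MvPolynomial (Fin n) ℝ) : Prop :=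
  (∀ s x, 0 ≤ evalBits (p s) x) ∧ ∀ x, ∑ s, evalBits (p s) x ≤ 1

/-- The polynomials `p` compute `f` to error `ε` in the worst case. -/
def PolyComputes (p : A → MvPolynomial (Fin n) ℝ) (f : QueryRel n A) (ε : ℝ) : Prop :=
  PolyBounded p ∧ ∀ x, (f x).Nonempty → 1 - ε ≤ ∑ s ∈ f x, evalBits (p s) x

/-- The polynomials `p` compute `f` to error `ε` against `μ`. -/
def PolyComputesDist (p : A → MvPolynomial (Fin n) ℝ) (f : QueryRel n A) (μ : Bits n → ℝ)
    (ε : ℝ) : Prop :=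
  PolyBounded p ∧
    1 - ε ≤ ∑ x with (f x).Nonempty, μ x * ∑ s ∈ f x, evalBits (p s) x

/-- The `ε`-approximate degree of `f`. -/
noncomputable def adeg (f : QueryRel n A) (ε : ℝ) : ℕ :=
  sInf {d | ∃ p : A → MvPolynomial (Fin n) ℝ, PolyComputes p f ε ∧ systemDegree p = d}

/-- The `ε`-approximate degree of `f` against `μ`. -/
noncomputable def adegDist (f : QueryRel n A) (μ : Bits n → ℝ) (ε : ℝ) : ℕ :=
  sInf {d | ∃ p : A → MvPolynomial (Fin n) ℝ, PolyComputesDist p f μ ε ∧ systemDegree p = d}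

end Degree

/-! ### Approximate `γ₂` norm of communication relations -/

section Gamma

variable {X Y : Type*} [Fintype X] [Fintype Y] {A : Type*} [Fintype A]

/-- The maximum Euclidean norm of a row. -/
noncomputable def maxRowNorm {I J : Type*} [Fintype J] (B : Matrix I J ℝ) : ℝ :=
  ⨆ i, Real.sqrt (∑ j, B i j ^ 2)

/-- The maximum Euclidean norm of a column. -/
noncomputable def maxColNorm {I J : Type*} [Fintype I] (C : Matrix I J ℝ) : ℝ :=
  ⨆ j, Real.sqrt (∑ i, C i j ^ 2)

/-- The `γ₂` norm of a real matrix: the infimum of `‖B‖_r ‖C‖_c` over all factorizations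
`B C = P`, through any inner dimension. -/
noncomputable def gamma2 {X Y : Type*} (P : Matrix X Y ℝ) : ℝ :=
  sInf {t | ∃ (k : ℕ) (B : Matrix X (Fin k) ℝ) (C : Matrix (Fin k) Y ℝ),
    B * C = P ∧ t = maxRowNorm B * maxColNorm C}

/-- A communication relation: the set of allowed outputs of each pair of inputs. -/
abbrev CommRel (X Y A : Type*) := X → Y → Finset A

/-- The entries of the matrices are nonnegative and sum to at most 1 at each position. -/
def MatBounded (P : A → Matrix X Y ℝ) : Prop :=
  (∀ c x y, 0 ≤ P c x y) ∧ ∀ x y, ∑ c, P c x y ≤ 1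

/-- The matrices `P` approximate `F` to error `ε` in the worst case. -/
def MatApprox (P : A → Matrix X Y ℝ) (F : CommRel X Y A) (ε : ℝ) : Prop :=
  MatBounded P ∧ ∀ x y, (F x y).Nonempty → 1 - ε ≤ ∑ c ∈ F x y, P c x y

/-- The matrices `P` approximate `F` to error `ε` with respect to `M`. -/
def MatApproxDist (P : A → Matrix X Y ℝ) (F : CommRel X Y A) (M : X × Y → ℝ) (ε : ℝ) : Prop :=
  MatBounded P ∧
    1 - ε ≤ ∑ z : X × Y with (F z.1 z.2).Nonempty, M z * ∑ c ∈ F z.1 z.2, P c z.1 z.2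

/-- The `γ₂` norm of a system of matrices, the maximum of their `γ₂` norms. -/
noncomputable def systemGamma2 (P : A → Matrix X Y ℝ) : ℝ≥0∞ :=
  ⨆ c, ENNReal.ofReal (gamma2 (P c))

/-- The `ε`-approximate `γ₂` norm of `F`; it is `∞` if no system approximates `F` to
error `ε`. -/
noncomputable def agamma2 (F : CommRel X Y A) (ε : ℝ) : ℝ≥0∞ :=
  ⨅ (P : A → Matrix X Y ℝ) (_ : MatApprox P F ε), systemGamma2 P

/-- The `ε`-approximate `γ₂` norm of `F` with respect to `M`; it is `∞` if no system
approximates `F` to error `ε` with respect to `M`. -/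
noncomputable def agamma2Dist (F : CommRel X Y A) (M : X × Y → ℝ) (ε : ℝ) : ℝ≥0∞ :=
  ⨅ (P : A → Matrix X Y ℝ) (_ : MatApproxDist P F M ε), systemGamma2 P

end Gamma

/-! ### Lifting -/

/-- Strings of `2n` bits, split into `n` consecutive blocks of two bits. -/
abbrev Blocks (n : ℕ) : Type := Fin n → Bool × Bool

/-- The gadget `G(x₁, x₂, y₁, y₂) = x₁ ⊕ y₁ ⊕ (x₂ ∧ y₂)`. -/
def gadget (x y : Bool × Bool) : Bool :=
  xor (xor x.1 y.1) (x.2 && y.2)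

/-- The gadget applied in each of the `n` blocks. -/
def gadgetPow {n : ℕ} (x y : Blocks n) : Bits n :=
  fun i => gadget (x i) (y i)

/-- The lifted relation `f ∘ Gⁿ`. -/
def liftRel {n : ℕ} {A : Type*} (f : QueryRel n A) : CommRel (Blocks n) (Blocks n) A :=
  fun x y => f (gadgetPow x y)

/-- The lifted distribution `2⁻³ⁿ μ ∘ Gⁿ`. -/
noncomputable def liftDist {n : ℕ} (μ : Bits n → ℝ) : Blocks n × Blocks n → ℝ :=
  fun z => (2 ^ (3 * n))⁻¹ * μ (gadgetPow z.1 z.2)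

end TotalSearch

open TotalSearch

namespace TotalSearch

/-! Averaging an approximating system `P` over the fibres of `Gⁿ` gives functions `q c = fibreAvg (P
c)` on the cube that are nonnegative, sum to at most 1, and solve `f` with success `2δ`. Suppose
some substochastic `r` made every `q c + r c` a polynomial of degree at most `d`. Then `(q + r) / 2`
would be an admissible polynomial system with success at least `δ`, which is impossible for `d` one
below the approximate degree. Adding `r` makes the failure of all such systems a separation problem
between a compact convex set and a translated subspace.

Hahn–Banach (`exists_dual_witness`) then gives functions `ψ c` orthogonal to degree at most `d` with
`⟨ψ, r⟩ + ⟨ψ, q⟩ < 0` for every substochastic `r`. Let `ψ m` have the largest ℓ₁ norm `L`. Taking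
for `r m` the indicator of `ψ m > 0` gives `⟨ψ, r⟩ = L / 2`, so `-⟨ψ, q⟩ > L / 2`.

In the other direction, `abs_lift_form_le` bounds the spectral norm of `ψ c ∘ Gⁿ`: the XOR bits
diagonalize it over the characters, and on the `S`-block the AND bits leave a Hadamard matrix, which
gains `√2 ^ |S|` with `|S| > d`. By duality (`abs_sum_mul_fibreAvg_le`) `|⟨ψ c, q c⟩| ≤ L / √2 ^ (d
+ 1) * γ₂(P c)`, so some `γ₂(P c)` is at least `√2 ^ (d + 1) / (2|A|)` (`exists_le_gamma2`). The
loss `2|A|` is affordable because a TFNP problem has only `exp (polylog n)` certificates. -/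

/-! ### Characters of the cube -/

/-- The sign `(-1)^b` of a bit. -/
def bitSign (b : Bool) : ℝ := if b then -1 else 1

/-- The character of the cube indexed by a set of coordinates. -/
def cubeChar {n : ℕ} (S : Finset (Fin n)) (x : Bits n) : ℝ := ∏ i ∈ S, bitSign (x i)

/-- The Hadamard kernel on the coordinates in `S`, constant in the others. -/
def hadamardKernel {n : ℕ} (S : Finset (Fin n)) (x y : Bits n) : ℝ :=
  ∏ i ∈ S, bitSign (x i && y i)

theorem abs_bitSign (b : Bool) : |bitSign b| = 1 := by cases b <;> simp [bitSign]

theorem bitSign_xor (a b : Bool) : bitSign (xor a b) = bitSign a * bitSign b := by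
  cases a <;> cases b <;> simp [bitSign]

theorem abs_cubeChar {n : ℕ} (S : Finset (Fin n)) (x : Bits n) : |cubeChar S x| = 1 := by
  simp [cubeChar, Finset.abs_prod, abs_bitSign]

theorem sum_cubeChar_mul {n : ℕ} (x y : Bits n) :
    ∑ S : Finset (Fin n), cubeChar S x * cubeChar S y = if x = y then 2 ^ n else 0 := by
  have h : ∑ S : Finset (Fin n), cubeChar S x * cubeChar S y
      = ∏ i, (1 + bitSign (x i) * bitSign (y i)) := by
    rw [Finset.prod_one_add, Finset.powerset_univ]
    exact Finset.sum_congr rfl fun S _ => by simp [cubeChar, Finset.prod_mul_distrib]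
  rw [h]
  have h2 : ∀ a b : Bool, 1 + bitSign a * bitSign b = if a = b then 2 else 0 := by
    intro a b
    cases a <;> cases b <;> norm_num [bitSign]
  simp only [h2]
  split_ifs with hxy
  · subst hxy
    simp
  · obtain ⟨i, hi⟩ := Function.ne_iff.1 hxy
    exact Finset.prod_eq_zero (Finset.mem_univ i) (by simp [hi])

/-- Fourier inversion on the cube. -/
theorem sum_coeff_mul_cubeChar {n : ℕ} (ψ : Bits n → ℝ) (z : Bits n) :
    (2 ^ n)⁻¹ * ∑ S, (∑ w, ψ w * cubeChar S w) * cubeChar S z = ψ z := by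
  have : ∑ S, (∑ w, ψ w * cubeChar S w) * cubeChar S z = 2 ^ n * ψ z := by
    simp only [Finset.sum_mul, mul_assoc]
    rw [Finset.sum_comm]
    simp only [← Finset.mul_sum, sum_cubeChar_mul]
    simp [mul_comm]
  rw [this]
  field_simp

/-- Parseval's identity on the cube. -/
theorem sum_sq_coeff {n : ℕ} (u : Bits n → ℝ) :
    ∑ S, (∑ x, cubeChar S x * u x) ^ 2 = 2 ^ n * ∑ x, u x ^ 2 := by
  have h : ∀ S : Finset (Fin n), (∑ x, cubeChar S x * u x) ^ 2
      = ∑ x, ∑ y, u x * u y * (cubeChar S x * cubeChar S y) := by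
    intro S
    rw [sq, Finset.sum_mul_sum]
    exact Finset.sum_congr rfl fun x _ => Finset.sum_congr rfl fun y _ => by ring
  simp only [h]
  rw [Finset.sum_comm, Finset.mul_sum]
  refine Finset.sum_congr rfl fun x _ => ?_
  rw [Finset.sum_comm]
  simp only [← Finset.mul_sum, sum_cubeChar_mul]
  simp
  ring

theorem sum_prod_pi {n : ℕ} {B : Type*} [Fintype B] [DecidableEq B] (k : Fin n → B → ℝ) :
    ∑ x : Fin n → B, ∏ i, k i (x i) = ∏ i, ∑ b, k i b := by
  rw [Finset.prod_univ_sum, Fintype.piFinset_univ]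

/-- The Schur test for a symmetric nonnegative kernel. -/
theorem sum_sum_le_of_row_sum {X : Type*} [Fintype X] (k : X → X → ℝ) (c : ℝ)
    (hk : ∀ x y, 0 ≤ k x y) (hsymm : ∀ x y, k x y = k y x) (hrow : ∀ x, ∑ y, k x y = c)
    (v : X → ℝ) : ∑ x, ∑ y, v x * v y * k x y ≤ c * ∑ x, v x ^ 2 := by
  have h1 : ∑ x, ∑ y, v x ^ 2 * k x y = c * ∑ x, v x ^ 2 := by
    simp only [← Finset.mul_sum, hrow]
    rw [← Finset.sum_mul, mul_comm]
  have h2 : ∑ x, ∑ y, v y ^ 2 * k x y = c * ∑ x, v x ^ 2 := by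
    rw [Finset.sum_comm, ← h1]
    exact Finset.sum_congr rfl fun x _ => Finset.sum_congr rfl fun y _ => by rw [hsymm]
  have h3 : ∑ x, ∑ y, v x * v y * k x y
      ≤ ∑ x, ∑ y, (v x ^ 2 * k x y / 2 + v y ^ 2 * k x y / 2) := by
    refine Finset.sum_le_sum fun x _ => Finset.sum_le_sum fun y _ => ?_
    nlinarith [mul_nonneg (hk x y) (sq_nonneg (v x - v y))]
  simp only [Finset.sum_add_distrib, ← Finset.sum_div, h1, h2] at h3
  linarith

/-- The Gram matrix of the kernel is a tensor product: twice the identity on coordinates in `S`, the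
constant 2 elsewhere. It is nonnegative with row sums `2 ^ |S| * 4 ^ (n - |S|)`, so the Schur test
applies. -/
theorem hadamardKernel_sq_sum_le {n : ℕ} (S : Finset (Fin n)) (v : Bits n → ℝ) :
    ∑ x, (∑ y, hadamardKernel S x y * v y) ^ 2 ≤ 4 ^ n / 2 ^ S.card * ∑ y, v y ^ 2 := by
  let k : Fin n → Bool → Bool → ℝ := fun i b b' => if i ∈ S then (if b = b' then 2 else 0) else 2
  have hk : ∀ y y' : Bits n, ∑ x, hadamardKernel S x y * hadamardKernel S x y'
      = ∏ i, k i (y i) (y' i) := by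
    intro y y'
    have h : ∀ x : Bits n, hadamardKernel S x y * hadamardKernel S x y'
        = ∏ i, if i ∈ S then bitSign (x i && y i) * bitSign (x i && y' i) else 1 := by
      intro x
      simp [hadamardKernel, Finset.prod_mul_distrib]
    simp only [h]
    rw [sum_prod_pi fun i b => if i ∈ S then bitSign (b && y i) * bitSign (b && y' i) else 1]
    refine Finset.prod_congr rfl fun i _ => ?_
    by_cases hi : i ∈ S
    · cases hy : y i <;> cases hy' : y' i <;> norm_num [k, hi, bitSign]
    · norm_num [k, hi]
  have hsq : ∀ x, (∑ y, hadamardKernel S x y * v y) ^ 2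
      = ∑ y, ∑ y', v y * v y' * (hadamardKernel S x y * hadamardKernel S x y') := by
    intro x
    rw [sq, Finset.sum_mul_sum]
    exact Finset.sum_congr rfl fun x _ => Finset.sum_congr rfl fun y _ => by ring
  have hexp : ∑ x, (∑ y, hadamardKernel S x y * v y) ^ 2
      = ∑ y, ∑ y', v y * v y' * ∏ i, k i (y i) (y' i) := by
    simp only [hsq]
    rw [Finset.sum_comm]
    refine Finset.sum_congr rfl fun y _ => ?_
    rw [Finset.sum_comm]
    exact Finset.sum_congr rfl fun y' _ => by rw [← Finset.mul_sum, hk]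
  rw [hexp]
  refine sum_sum_le_of_row_sum _ _ ?_ ?_ ?_ v
  · intro x y
    refine Finset.prod_nonneg fun i _ => ?_
    simp only [k]
    split_ifs <;> norm_num
  · intro x y
    refine Finset.prod_congr rfl fun i _ => ?_
    simp only [k, eq_comm]
  · intro y
    rw [sum_prod_pi fun i b => k i (y i) b]
    have : ∀ i, ∑ b, k i (y i) b = 4 * if i ∈ S then (2 : ℝ)⁻¹ else 1 := by
      intro i
      by_cases hi : i ∈ S
      · cases hy : y i <;> norm_num [k, hi]
      · norm_num [k, hi]
    rw [Finset.prod_congr rfl fun i _ => this i, Finset.prod_mul_distrib]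
    simp [div_eq_mul_inv]

theorem abs_hadamardKernel_form_le {n : ℕ} (S : Finset (Fin n)) (u v : Bits n → ℝ) :
    |∑ x, ∑ y, u x * hadamardKernel S x y * v y|
      ≤ 2 ^ n / √2 ^ S.card * (√(∑ x, u x ^ 2) * √(∑ y, v y ^ 2)) := by
  have h := Finset.sum_mul_sq_le_sq_mul_sq Finset.univ u
    fun x => ∑ y, hadamardKernel S x y * v y
  have he : ∑ x, ∑ y, u x * hadamardKernel S x y * v y
      = ∑ x, u x * ∑ y, hadamardKernel S x y * v y := by
    simp only [Finset.mul_sum, mul_assoc]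
  have hu : 0 ≤ ∑ x, u x ^ 2 := Finset.sum_nonneg fun _ _ => sq_nonneg _
  have hv : 0 ≤ ∑ x, v x ^ 2 := Finset.sum_nonneg fun _ _ => sq_nonneg _
  rw [he]
  refine abs_le_of_sq_le_sq ?_ (by positivity)
  refine h.trans ((mul_le_mul_of_nonneg_left (hadamardKernel_sq_sum_le S v) hu).trans_eq ?_)
  rw [mul_pow, mul_pow, Real.sq_sqrt hu, Real.sq_sqrt hv, div_pow, ← pow_mul, ← pow_mul,
    mul_comm n, mul_comm S.card, pow_mul, pow_mul, Real.sq_sqrt (by norm_num)]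
  norm_num
  ring

/-! ### The lifted kernel -/

theorem sum_blocks {n : ℕ} (F : Blocks n → ℝ) :
    ∑ x, F x = ∑ b : Bits n, ∑ a : Bits n, F fun i => (a i, b i) := by
  rw [Finset.sum_comm, ← Fintype.sum_prod_type']
  exact Fintype.sum_equiv
    (Equiv.arrowProdEquivProdArrow (Fin n) (fun _ => Bool) (fun _ => Bool)) _ _ fun x => rfl

/-- Signs turn XOR into a product, so the first bits of the blocks separate and only the AND of the
second bits couples the two players. -/
theorem cubeChar_gadgetPow {n : ℕ} (S : Finset (Fin n)) (a b a' b' : Bits n) :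
    cubeChar S (gadgetPow (fun i => (a i, b i)) fun i => (a' i, b' i))
      = cubeChar S a * cubeChar S a' * hadamardKernel S b b' := by
  simp [cubeChar, gadgetPow, gadget, hadamardKernel, bitSign_xor, Finset.prod_mul_distrib, mul_assoc]

theorem sum_cubeChar_gadgetPow {n : ℕ} (S : Finset (Fin n)) (u v : Blocks n → ℝ) :
    ∑ x, ∑ y, u x * cubeChar S (gadgetPow x y) * v y
      = ∑ b, ∑ b', (∑ a, cubeChar S a * u fun i => (a i, b i)) * hadamardKernel S b b'
          * ∑ a', cubeChar S a' * v fun i => (a' i, b' i) := by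
  rw [sum_blocks]
  refine Finset.sum_congr rfl fun b _ => ?_
  simp only [sum_blocks (n := n), cubeChar_gadgetPow]
  rw [Finset.sum_comm]
  refine Finset.sum_congr rfl fun b' _ => ?_
  simp only [Finset.sum_mul, Finset.mul_sum]
  rw [Finset.sum_comm]
  exact Finset.sum_congr rfl fun x _ => Finset.sum_congr rfl fun y _ => by ring

theorem sum_sq_block_coeff {n : ℕ} (u : Blocks n → ℝ) :
    ∑ S, ∑ b : Bits n, (∑ a, cubeChar S a * u fun i => (a i, b i)) ^ 2 = 2 ^ n * ∑ x, u x ^ 2 := by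
  rw [Finset.sum_comm, sum_blocks, Finset.mul_sum]
  exact Finset.sum_congr rfl fun b _ => sum_sq_coeff _

/-- The spectral norm of the lift of a function of pure high degree. -/
theorem abs_lift_form_le {n d : ℕ} (ψ : Bits n → ℝ)
    (hψ : ∀ S : Finset (Fin n), S.card ≤ d → ∑ z, ψ z * cubeChar S z = 0) (u v : Blocks n → ℝ) :
    |∑ x, ∑ y, u x * ψ (gadgetPow x y) * v y|
      ≤ 2 ^ n / √2 ^ (d + 1) * (∑ z, |ψ z|) * (√(∑ x, u x ^ 2) * √(∑ y, v y ^ 2)) := by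
  set L := ∑ z, |ψ z| with hL
  have hL0 : 0 ≤ L := Finset.sum_nonneg fun _ _ => abs_nonneg _
  let U : Finset (Fin n) → ℝ := fun S => ∑ b : Bits n, (∑ a, cubeChar S a * u fun i => (a i, b i)) ^ 2
  let V : Finset (Fin n) → ℝ := fun S => ∑ b : Bits n, (∑ a, cubeChar S a * v fun i => (a i, b i)) ^ 2
  have hU : ∀ S, 0 ≤ U S := fun S => Finset.sum_nonneg fun _ _ => sq_nonneg _
  have hV : ∀ S, 0 ≤ V S := fun S => Finset.sum_nonneg fun _ _ => sq_nonneg _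
  have hexp : ∑ x, ∑ y, u x * ψ (gadgetPow x y) * v y
      = (2 ^ n)⁻¹ * ∑ S, (∑ w, ψ w * cubeChar S w)
          * ∑ x, ∑ y, u x * cubeChar S (gadgetPow x y) * v y := by
    have hpt : ∀ x y, u x * ψ (gadgetPow x y) * v y = (2 ^ n)⁻¹ * ∑ S,
        (∑ w, ψ w * cubeChar S w) * (u x * cubeChar S (gadgetPow x y) * v y) := by
      intro x y
      rw [← sum_coeff_mul_cubeChar ψ (gadgetPow x y), mul_left_comm, mul_assoc, Finset.mul_sum,
        Finset.sum_mul]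
      congr 1
      exact Finset.sum_congr rfl fun S _ => by ring
    simp only [hpt, ← Finset.mul_sum]
    congr 1
    generalize (fun S => ∑ w, ψ w * cubeChar S w) = c
    simp only [Finset.mul_sum]
    conv_rhs => rw [Finset.sum_comm]
    refine Finset.sum_congr rfl fun x _ => ?_
    rw [Finset.sum_comm]
  have hterm : ∀ S : Finset (Fin n), |(∑ w, ψ w * cubeChar S w)
        * ∑ x, ∑ y, u x * cubeChar S (gadgetPow x y) * v y|
      ≤ L * (2 ^ n / √2 ^ (d + 1)) * (√(U S) * √(V S)) := by
    intro S
    by_cases hS : S.card ≤ d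
    · rw [hψ S hS, zero_mul, abs_zero]
      positivity
    · rw [abs_mul, mul_assoc]
      refine mul_le_mul ?_ ?_ (abs_nonneg _) hL0
      · refine (Finset.abs_sum_le_sum_abs _ _).trans_eq ?_
        simp [abs_mul, abs_cubeChar, hL]
      · rw [sum_cubeChar_gadgetPow]
        refine (abs_hadamardKernel_form_le S _ _).trans ?_
        refine mul_le_mul_of_nonneg_right ?_ (by positivity)
        have h1 : (1 : ℝ) ≤ √2 := Real.one_le_sqrt.2 (by norm_num)
        have h2 : d + 1 ≤ S.card := by omega
        gcongr
  -- Parseval in the first bits makes the blocks for different `S` orthogonal, so the total costs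
  -- only the worst block and not a sum of `2 ^ n` block norms.
  have hCS : ∑ S, √(U S) * √(V S) ≤ 2 ^ n * (√(∑ x, u x ^ 2) * √(∑ y, v y ^ 2)) := by
    refine (Real.sum_sqrt_mul_sqrt_le _ hU hV).trans_eq ?_
    simp only [U, V]
    rw [sum_sq_block_coeff, sum_sq_block_coeff, Real.sqrt_mul (by positivity),
      Real.sqrt_mul (by positivity), mul_mul_mul_comm, Real.mul_self_sqrt (by positivity)]
  rw [hexp, abs_mul, abs_of_nonneg (by positivity)]
  calc (2 ^ n)⁻¹ * |∑ S, (∑ w, ψ w * cubeChar S w)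
          * ∑ x, ∑ y, u x * cubeChar S (gadgetPow x y) * v y|
      ≤ (2 ^ n)⁻¹ * ∑ S, L * (2 ^ n / √2 ^ (d + 1)) * (√(U S) * √(V S)) := by
        gcongr
        exact (Finset.abs_sum_le_sum_abs _ _).trans (Finset.sum_le_sum fun S _ => hterm S)
    _ ≤ (2 ^ n)⁻¹ * (L * (2 ^ n / √2 ^ (d + 1))
          * (2 ^ n * (√(∑ x, u x ^ 2) * √(∑ y, v y ^ 2)))) := by
        rw [← Finset.mul_sum]
        gcongr
    _ = _ := by field_simp

/-! ### Averaging over the fibres of the gadget -/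

/-- The gadget is balanced: flipping `x₁` flips its output, so 8 of the 16 inputs of a block give
each value. -/
theorem sum_gadget_fibre {n : ℕ} (z : Bits n) :
    ∑ x : Blocks n, ∑ y : Blocks n, (if gadgetPow x y = z then (1 : ℝ) else 0) = 8 ^ n := by
  have h : ∀ x y : Blocks n, (if gadgetPow x y = z then (1 : ℝ) else 0)
      = ∏ i, if gadget (x i) (y i) = z i then 1 else 0 := by
    intro x y
    rw [Finset.prod_ite_zero]
    simp [funext_iff, gadgetPow]
  simp only [h]
  have h2 : ∀ x : Blocks n, ∑ y : Blocks n, ∏ i, (if gadget (x i) (y i) = z i then (1 : ℝ) else 0)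
      = ∏ i, ∑ b, if gadget (x i) b = z i then (1 : ℝ) else 0 :=
    fun x => sum_prod_pi fun i b => if gadget (x i) b = z i then (1 : ℝ) else 0
  simp only [h2]
  rw [sum_prod_pi fun i a => ∑ b, if gadget a b = z i then (1 : ℝ) else 0]
  have h3 : ∀ c : Bool, ∑ a, ∑ b, (if gadget a b = c then (1 : ℝ) else 0) = 8 := by
    intro c
    simp only [Fintype.sum_prod_type, Fintype.sum_bool, gadget]
    cases c <;> norm_num
  rw [Finset.prod_congr rfl fun i _ => h3 (z i)]
  simp

/-- The average of a matrix over the fibre of `z` under the gadget. -/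
noncomputable def fibreAvg {n : ℕ} (P : Matrix (Blocks n) (Blocks n) ℝ) (z : Bits n) : ℝ :=
  (8 ^ n)⁻¹ * ∑ x, ∑ y, if gadgetPow x y = z then P x y else 0

theorem sum_mul_fibreAvg {n : ℕ} (ψ : Bits n → ℝ) (P : Matrix (Blocks n) (Blocks n) ℝ) :
    ∑ z, ψ z * fibreAvg P z = (8 ^ n)⁻¹ * ∑ x, ∑ y, ψ (gadgetPow x y) * P x y := by
  have h : ∀ z, ψ z * fibreAvg P z
      = (8 ^ n)⁻¹ * ∑ x, ∑ y, if gadgetPow x y = z then ψ z * P x y else 0 := by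
    intro z
    rw [fibreAvg, mul_left_comm, Finset.mul_sum]
    simp only [Finset.mul_sum, mul_ite, mul_zero]
  simp only [h]
  rw [← Finset.mul_sum, Finset.sum_comm]
  congr 1
  refine Finset.sum_congr rfl fun x _ => ?_
  rw [Finset.sum_comm]
  simp

theorem fibreAvg_nonneg {n : ℕ} {P : Matrix (Blocks n) (Blocks n) ℝ} (hP : ∀ x y, 0 ≤ P x y)
    (z : Bits n) : 0 ≤ fibreAvg P z := by
  refine mul_nonneg (by positivity) (Finset.sum_nonneg fun x _ => Finset.sum_nonneg fun y _ => ?_)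
  split_ifs
  exacts [hP x y, le_rfl]

theorem le_fibreAvg_of_le {n : ℕ} {P : Matrix (Blocks n) (Blocks n) ℝ} {z : Bits n} {t : ℝ}
    (h : ∀ x y, gadgetPow x y = z → t ≤ P x y) : t ≤ fibreAvg P z := by
  rw [fibreAvg, inv_mul_eq_div, le_div_iff₀ (by positivity), ← sum_gadget_fibre z, Finset.mul_sum]
  refine Finset.sum_le_sum fun x _ => ?_
  rw [Finset.mul_sum]
  refine Finset.sum_le_sum fun y _ => ?_
  split_ifs with hz
  · simpa using h x y hz
  · simp

theorem fibreAvg_le_of_le {n : ℕ} {P : Matrix (Blocks n) (Blocks n) ℝ} {z : Bits n} {t : ℝ}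
    (h : ∀ x y, gadgetPow x y = z → P x y ≤ t) : fibreAvg P z ≤ t := by
  rw [fibreAvg, inv_mul_eq_div, div_le_iff₀ (by positivity), ← sum_gadget_fibre z, Finset.mul_sum]
  refine Finset.sum_le_sum fun x _ => ?_
  rw [Finset.mul_sum]
  refine Finset.sum_le_sum fun y _ => ?_
  split_ifs with hz
  · simpa using h x y hz
  · simp

theorem sum_fibreAvg {n : ℕ} {A : Type*} (T : Finset A) (P : A → Matrix (Blocks n) (Blocks n) ℝ)
    (z : Bits n) : ∑ c ∈ T, fibreAvg (P c) z = fibreAvg (∑ c ∈ T, P c) z := by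
  simp only [fibreAvg, ← Finset.mul_sum]
  congr 1
  rw [Finset.sum_comm]
  refine Finset.sum_congr rfl fun x _ => ?_
  rw [Finset.sum_comm]
  refine Finset.sum_congr rfl fun y _ => ?_
  split_ifs <;> simp [Matrix.sum_apply]

theorem liftDist_mem_stdSimplex {n : ℕ} {μ : Bits n → ℝ} (hμ : μ ∈ stdSimplex ℝ (Bits n)) :
    liftDist μ ∈ stdSimplex ℝ (Blocks n × Blocks n) := by
  refine ⟨fun z => mul_nonneg (by positivity) (hμ.1 _), ?_⟩
  have h1 : ∀ z : Bits n, fibreAvg (fun _ _ => (1 : ℝ)) z = 1 := by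
    intro z
    refine (congrArg ((8 ^ n : ℝ)⁻¹ * ·) (sum_gadget_fibre z)).trans ?_
    field_simp
  have h := sum_mul_fibreAvg μ fun _ _ => 1
  simp only [h1, mul_one, hμ.2] at h
  rw [Fintype.sum_prod_type]
  simp only [liftDist, ← Finset.mul_sum, pow_mul]
  norm_num
  exact h.symm

/-! ### The `γ₂` bound for dual polynomials -/

theorem sqrt_le_maxRowNorm {I J : Type*} [Finite I] [Fintype J] (B : Matrix I J ℝ) (i : I) :
    √(∑ j, B i j ^ 2) ≤ maxRowNorm B :=
  le_ciSup (f := fun i => √(∑ j, B i j ^ 2)) (Set.finite_range _).bddAbove i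

theorem sqrt_le_maxColNorm {I J : Type*} [Fintype I] [Finite J] (C : Matrix I J ℝ) (j : J) :
    √(∑ i, C i j ^ 2) ≤ maxColNorm C :=
  le_ciSup (f := fun j => √(∑ i, C i j ^ 2)) (Set.finite_range _).bddAbove j

theorem sqrt_sum_le_of_sqrt_le {I J : Type*} [Fintype I] [Fintype J] (F : I → J → ℝ) (b : ℝ)
    (hF : ∀ i, √(∑ j, F i j ^ 2) ≤ b) (hb : 0 ≤ b) :
    √(∑ i, ∑ j, F i j ^ 2) ≤ √(Fintype.card I) * b := by
  have h : ∑ i, ∑ j, F i j ^ 2 ≤ Fintype.card I * b ^ 2 := by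
    rw [← nsmul_eq_mul]
    exact Finset.sum_le_card_nsmul _ _ _ fun i _ => (Real.sqrt_le_left hb).1 (hF i)
  refine (Real.sqrt_le_sqrt h).trans_eq ?_
  rw [Real.sqrt_mul (by positivity), Real.sqrt_sq hb]

/-- A factorization of `P` splits the pairing with `ψ ∘ Gⁿ` into bilinear forms, one per inner
index, each controlled by the spectral norm. Cauchy–Schwarz over the inner index leaves the
Frobenius norms of the factors, at most `√(4 ^ n)` times their row and column norms; the powers `2 ^
n * 4 ^ n` cancel the `8 ^ n` of the average. -/
theorem abs_sum_mul_fibreAvg_le {n d : ℕ} (ψ : Bits n → ℝ)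
    (hψ : ∀ S : Finset (Fin n), S.card ≤ d → ∑ z, ψ z * cubeChar S z = 0)
    (P : Matrix (Blocks n) (Blocks n) ℝ) :
    |∑ z, ψ z * fibreAvg P z| ≤ (∑ z, |ψ z|) / √2 ^ (d + 1) * gamma2 P := by
  classical
  set L := ∑ z, |ψ z| with hL
  have hL0 : 0 ≤ L := Finset.sum_nonneg fun _ _ => abs_nonneg _
  have key : ∀ t ∈ {t | ∃ (k : ℕ) (B : Matrix (Blocks n) (Fin k) ℝ)
      (C : Matrix (Fin k) (Blocks n) ℝ), B * C = P ∧ t = maxRowNorm B * maxColNorm C},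
      |∑ z, ψ z * fibreAvg P z| ≤ L / √2 ^ (d + 1) * t := by
    rintro t ⟨k, B, C, rfl, rfl⟩
    have hb : 0 ≤ maxRowNorm B := Real.iSup_nonneg fun _ => Real.sqrt_nonneg _
    have hc : 0 ≤ maxColNorm C := Real.iSup_nonneg fun _ => Real.sqrt_nonneg _
    have hcard : (Fintype.card (Blocks n) : ℝ) = 4 ^ n := by norm_num [Blocks]
    have hB := sqrt_sum_le_of_sqrt_le (fun x j => B x j) _ (sqrt_le_maxRowNorm B) hb
    have hC := sqrt_sum_le_of_sqrt_le (fun y j => C j y) _ (sqrt_le_maxColNorm C) hc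
    rw [hcard, Finset.sum_comm] at hB hC
    have hexp : ∑ x, ∑ y, ψ (gadgetPow x y) * (B * C) x y
        = ∑ j, ∑ x, ∑ y, B x j * ψ (gadgetPow x y) * C j y := by
      simp only [Matrix.mul_apply, Finset.mul_sum]
      rw [Finset.sum_comm' (s := Finset.univ) (t := fun _ => Finset.univ)
        (t' := Finset.univ) (s' := fun _ => Finset.univ) (by simp)]
      rw [Finset.sum_comm]
      conv_rhs => rw [Finset.sum_comm]
      refine Finset.sum_congr rfl fun x _ => ?_
      rw [Finset.sum_comm]
      exact Finset.sum_congr rfl fun j _ => Finset.sum_congr rfl fun y _ => by ring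
    rw [sum_mul_fibreAvg, hexp, abs_mul, abs_of_nonneg (by positivity)]
    calc (8 ^ n)⁻¹ * |∑ j, ∑ x, ∑ y, B x j * ψ (gadgetPow x y) * C j y|
        ≤ (8 ^ n)⁻¹ * ∑ j, 2 ^ n / √2 ^ (d + 1) * L
            * (√(∑ x, B x j ^ 2) * √(∑ y, C j y ^ 2)) := by
          gcongr
          exact (Finset.abs_sum_le_sum_abs _ _).trans
            (Finset.sum_le_sum fun j _ => abs_lift_form_le ψ hψ _ _)
      _ ≤ (8 ^ n)⁻¹ * (2 ^ n / √2 ^ (d + 1) * L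
            * ((√(4 ^ n) * maxRowNorm B) * (√(4 ^ n) * maxColNorm C))) := by
          rw [← Finset.mul_sum]
          gcongr
          refine (Real.sum_sqrt_mul_sqrt_le _ (fun _ => Finset.sum_nonneg fun _ _ => sq_nonneg _)
            fun _ => Finset.sum_nonneg fun _ _ => sq_nonneg _).trans ?_
          gcongr
      _ = L / √2 ^ (d + 1) * (maxRowNorm B * maxColNorm C) := by
          rw [mul_mul_mul_comm (√(4 ^ n)), Real.mul_self_sqrt (by positivity),
            show (8 : ℝ) = 2 * 4 by norm_num, mul_pow]
          field_simp
  -- The trivial factorization `P * 1`, reindexed through `Fin`, ensures that the infimum is not the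
  -- default value 0 of an empty set.
  have hne : {t | ∃ (k : ℕ) (B : Matrix (Blocks n) (Fin k) ℝ)
      (C : Matrix (Fin k) (Blocks n) ℝ), B * C = P ∧ t = maxRowNorm B * maxColNorm C}.Nonempty := by
    let e := Fintype.equivFin (Blocks n)
    exact ⟨_, _, P.submatrix id e.symm, (1 : Matrix (Blocks n) (Blocks n) ℝ).submatrix e.symm id,
      by rw [Matrix.submatrix_mul_equiv]; simp, rfl⟩
  rcases (div_nonneg hL0 (by positivity : (0 : ℝ) ≤ √2 ^ (d + 1))).eq_or_lt with h0 | h0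
  · obtain ⟨t, ht⟩ := hne
    simpa [← h0] using key t ht
  · rw [← div_le_iff₀' h0]
    exact le_csInf hne fun t ht => (div_le_iff₀' h0).2 (key t ht)

/-! ### Separation from low-degree polynomials -/

/-- The polynomials of degree at most `d` as functions on the cube. -/
noncomputable def lowDegree (n d : ℕ) : Submodule ℝ (Bits n → ℝ) :=
  (MvPolynomial.restrictTotalDegree (Fin n) ℝ d).map
    (LinearMap.pi fun x => (MvPolynomial.aeval
      (fun i => if x i then (1 : ℝ) else 0)).toLinearMap)

theorem mem_lowDegree {n d : ℕ} {w : Bits n → ℝ} :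
    w ∈ lowDegree n d ↔
      ∃ p : MvPolynomial (Fin n) ℝ, p.totalDegree ≤ d ∧ ∀ x, evalBits p x = w x := by
  have he : ∀ (p : MvPolynomial (Fin n) ℝ) (x : Bits n),
      MvPolynomial.aeval (fun i => if x i then (1 : ℝ) else 0) p = evalBits p x := fun p x => by
    rw [evalBits, ← MvPolynomial.coe_aeval_eq_eval]
    rfl
  simp [lowDegree, Submodule.mem_map, MvPolynomial.mem_restrictTotalDegree, funext_iff, he]

theorem cubeChar_mem_lowDegree {n d : ℕ} {S : Finset (Fin n)} (hS : S.card ≤ d) :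
    cubeChar S ∈ lowDegree n d := by
  refine mem_lowDegree.2 ⟨∏ i ∈ S, (1 - 2 * MvPolynomial.X i), ?_, fun x => ?_⟩
  · refine (MvPolynomial.totalDegree_finsetProd _ _).trans (le_trans ?_ hS)
    rw [Finset.card_eq_sum_ones]
    refine Finset.sum_le_sum fun i _ => (MvPolynomial.totalDegree_sub _ _).trans ?_
    refine max_le (by simp) ((MvPolynomial.totalDegree_mul _ _).trans ?_)
    have : (2 : MvPolynomial (Fin n) ℝ).totalDegree = 0 := MvPolynomial.totalDegree_C 2
    simp [this]
  · rw [evalBits, map_prod]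
    refine Finset.prod_congr rfl fun i _ => ?_
    cases hx : x i <;> norm_num [bitSign, hx]

/-- Systems of nonnegative functions that sum to at most 1 at each point. -/
def SubStochastic {n : ℕ} {A : Type*} [Fintype A] (r : A → Bits n → ℝ) : Prop :=
  (∀ c x, 0 ≤ r c x) ∧ ∀ x, ∑ c, r c x ≤ 1

theorem convex_subStochastic {n : ℕ} {A : Type*} [Fintype A] :
    Convex ℝ {r : A → Bits n → ℝ | SubStochastic r} := by
  intro r hr s hs a b ha hb hab
  refine ⟨fun c x => ?_, fun x => ?_⟩
  · exact add_nonneg (mul_nonneg ha (hr.1 c x)) (mul_nonneg hb (hs.1 c x))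
  · have : ∑ c, (a • r + b • s) c x = a * ∑ c, r c x + b * ∑ c, s c x := by
      simp [Finset.sum_add_distrib, Finset.mul_sum]
    rw [this]
    nlinarith [mul_le_mul_of_nonneg_left (hr.2 x) ha, mul_le_mul_of_nonneg_left (hs.2 x) hb]

theorem isCompact_subStochastic {n : ℕ} {A : Type*} [Fintype A] :
    IsCompact {r : A → Bits n → ℝ | SubStochastic r} := by
  have hbox : IsCompact (Set.univ.pi fun _ : A => Set.univ.pi fun _ : Bits n => Set.Icc (0 : ℝ) 1) :=
    isCompact_univ_pi fun _ => isCompact_univ_pi fun _ => isCompact_Icc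
  refine hbox.of_isClosed_subset ?_ fun r hr c _ x _ => ⟨hr.1 c x, ?_⟩
  · simp only [SubStochastic, Set.ofPred_and, Set.ofPred_forall]
    refine (isClosed_iInter fun c => isClosed_iInter fun x => ?_).inter (isClosed_iInter fun x => ?_)
    · exact isClosed_le continuous_const (by fun_prop)
    · exact isClosed_le (by fun_prop) continuous_const
  · exact (Finset.single_le_sum (fun c _ => hr.1 c x) (Finset.mem_univ c)).trans (hr.2 x)

/-- A dual witness for a system `q` such that no `q + r` with `r` substochastic is a system of
functions in `W`. -/
theorem exists_dual_witness {n : ℕ} {A : Type*} [Fintype A] (W : Submodule ℝ (Bits n → ℝ))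
    (q : A → Bits n → ℝ) (h : ∀ r : A → Bits n → ℝ, SubStochastic r → ∃ c, q c + r c ∉ W) :
    ∃ ψ : A → Bits n → ℝ, (∀ c, ∀ w ∈ W, ∑ x, ψ c x * w x = 0) ∧
      ∀ r : A → Bits n → ℝ, SubStochastic r →
        ∑ c, ∑ x, ψ c x * r c x + ∑ c, ∑ x, ψ c x * q c x < 0 := by
  classical
  let V : Submodule ℝ (A → Bits n → ℝ) := Submodule.pi Set.univ fun _ => W
  have hT : Convex ℝ ((fun t => q + t) ⁻¹' (V : Set (A → Bits n → ℝ))) :=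
    V.convex.translate_preimage_right q
  have hTc : IsClosed ((fun t => q + t) ⁻¹' (V : Set (A → Bits n → ℝ))) :=
    V.closed_of_finiteDimensional.preimage (by fun_prop)
  obtain ⟨f, u, v, hfu, huv, hfv⟩ := geometric_hahn_banach_compact_closed
    (convex_subStochastic (n := n) (A := A)) isCompact_subStochastic hT hTc (by
      rw [Set.disjoint_left]
      intro r hr hrT
      obtain ⟨c, hc⟩ := h r hr
      exact hc (hrT c trivial))
  -- A functional bounded below on a translate of a subspace vanishes on it: otherwise a multiple of
  -- `w`, translated by `-q`, attains exactly the excluded value `v`.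
  have hfV : ∀ w ∈ V, f w = 0 := by
    intro w hw
    by_contra hne
    have h1 := hfv (((v + f q) / f w) • w - q) (by
      have := V.smul_mem ((v + f q) / f w) hw
      simpa using this)
    rw [map_sub, map_smul, smul_eq_mul, div_mul_cancel₀ _ hne] at h1
    linarith
  have hrep : ∀ g : A → Bits n → ℝ,
      ∑ c, ∑ x, f (Pi.single c (Pi.single x 1)) * g c x = f g := by
    intro g
    have hg : g = ∑ c, ∑ x, g c x • Pi.single c (Pi.single x (1 : ℝ)) := by
      ext c x
      simp [Finset.sum_apply, Pi.single_apply, apply_ite, ite_apply]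
    conv_rhs => rw [hg]
    simp only [map_sum, map_smul, smul_eq_mul, mul_comm]
  refine ⟨fun c x => f (Pi.single c (Pi.single x 1)), fun c w hw => ?_, fun r hr => ?_⟩
  · have h1 := hrep (Pi.single c w)
    rw [hfV _ (by
      intro c' _
      rcases eq_or_ne c' c with rfl | hc
      · simpa using hw
      · simp [hc])] at h1
    rw [← h1, Finset.sum_eq_single c]
    · simp
    · intro c' _ hc
      simp [hc]
    · simp
  · rw [hrep, hrep]
    have h1 := hfu r hr
    have h2 := hfv (-q) (by simp)
    rw [map_neg] at h2
    linarith

/-- If every `γ₂` norm were smaller, each pairing of `ψ c` with `fibreAvg (P c)` would be at least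
`-L m / (2|A|)`, with `L m` the largest ℓ₁ norm. Their sum could not offset the `L m / 2` obtained
from a suitable `r`. -/
theorem exists_le_gamma2 {n d : ℕ} {A : Type*} [Fintype A]
    (P : A → Matrix (Blocks n) (Blocks n) ℝ)
    (h : ∀ r : A → Bits n → ℝ, SubStochastic r → ∃ c, fibreAvg (P c) + r c ∉ lowDegree n d) :
    ∃ c, √2 ^ (d + 1) / (2 * Fintype.card A) ≤ gamma2 (P c) := by
  classical
  obtain ⟨ψ, hψW, hψ⟩ := exists_dual_witness _ _ h
  have hA : Nonempty A := by
    by_contra hA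
    rw [not_nonempty_iff] at hA
    exact (hψ 0 ⟨by simp, by simp⟩).ne (by simp)
  have hcard : (0 : ℝ) < Fintype.card A := by exact_mod_cast Fintype.card_pos
  have hchar : ∀ c, ∀ S : Finset (Fin n), S.card ≤ d → ∑ z, ψ c z * cubeChar S z = 0 :=
    fun c S hS => hψW c _ (cubeChar_mem_lowDegree hS)
  by_contra! hlt
  let L : A → ℝ := fun c => ∑ z, |ψ c z|
  have hL0 : ∀ c, 0 ≤ L c := fun c => Finset.sum_nonneg fun _ _ => abs_nonneg _
  obtain ⟨m, hm⟩ := Finite.exists_max L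
  have hmean : ∑ z, ψ m z = 0 := by simpa [cubeChar] using hchar m ∅ (by simp)
  -- All mass goes to the output `m`, where `ψ m` is positive. As `ψ m` has mean zero, its positive
  -- part carries half of its ℓ₁ norm.
  have hr := hψ (fun c x => if c = m ∧ 0 < ψ m x then 1 else 0)
    ⟨fun c x => by positivity, fun x => by
      by_cases hx : 0 < ψ m x <;> simp [hx]⟩
  have hpos : ∑ c, ∑ x, ψ c x * (if c = m ∧ 0 < ψ m x then 1 else 0) = L m / 2 := by
    rw [Finset.sum_eq_single m (fun c _ hc => by simp [hc]) (by simp)]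
    have : ∀ x, ψ m x * (if m = m ∧ 0 < ψ m x then 1 else 0) = |ψ m x| / 2 + ψ m x / 2 := by
      intro x
      by_cases hx : 0 < ψ m x
      · simp [hx, abs_of_pos hx]
      · simp [hx, abs_of_nonpos (not_lt.1 hx)]
        ring
    rw [Finset.sum_congr rfl fun x _ => this x, Finset.sum_add_distrib, ← Finset.sum_div,
      ← Finset.sum_div, hmean, zero_div, add_zero]
  rw [hpos] at hr
  have hle : ∀ c, -(L m / (2 * Fintype.card A)) ≤ ∑ x, ψ c x * fibreAvg (P c) x := by
    intro c
    refine neg_le_of_abs_le ((abs_sum_mul_fibreAvg_le _ (hchar c) (P c)).trans ?_)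
    calc L c / √2 ^ (d + 1) * gamma2 (P c)
        ≤ L c / √2 ^ (d + 1) * (√2 ^ (d + 1) / (2 * Fintype.card A)) :=
          mul_le_mul_of_nonneg_left (hlt c).le (div_nonneg (hL0 c) (by positivity))
      _ = L c / (2 * Fintype.card A) := by field_simp
      _ ≤ L m / (2 * Fintype.card A) := by
          gcongr
          exact hm c
  have hsum := Finset.card_nsmul_le_sum Finset.univ _ _ fun c _ => hle c
  rw [nsmul_eq_mul, Finset.card_univ] at hsum
  have : (Fintype.card A : ℝ) * -(L m / (2 * Fintype.card A)) = -(L m / 2) := by field_simp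
  linarith

/-! ### Lifting approximate degree -/

theorem subStochastic_fibreAvg {n : ℕ} {A : Type*} [Fintype A]
    {P : A → Matrix (Blocks n) (Blocks n) ℝ} (hP : MatBounded P) :
    SubStochastic fun c => fibreAvg (P c) := by
  refine ⟨fun c => fibreAvg_nonneg (hP.1 c), fun z => ?_⟩
  rw [sum_fibreAvg]
  refine fibreAvg_le_of_le fun x y _ => ?_
  rw [Matrix.sum_apply]
  exact hP.2 x y

/-- The polynomials are `(q + r) / 2`: halving restores the sum bound for two substochastic systems,
and `r ≥ 0` keeps at least half of `q`. This is the source of the `2δ` against `δ`. -/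
theorem exists_le_gamma2_or_poly {n : ℕ} {A : Type*} [Fintype A] (d : ℕ)
    {P : A → Matrix (Blocks n) (Blocks n) ℝ} (hP : MatBounded P) :
    (∃ c, √2 ^ (d + 1) / (2 * Fintype.card A) ≤ gamma2 (P c)) ∨
      ∃ p : A → MvPolynomial (Fin n) ℝ, systemDegree p ≤ d ∧ PolyBounded p ∧
        ∀ c x, fibreAvg (P c) x / 2 ≤ evalBits (p c) x := by
  refine or_iff_not_imp_right.2 fun hp => exists_le_gamma2 P fun r hr => ?_
  by_contra! hmem
  have hhalf : ∀ c, ∃ p : MvPolynomial (Fin n) ℝ, p.totalDegree ≤ d ∧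
      ∀ x, evalBits p x = (fibreAvg (P c) x + r c x) / 2 := by
    intro c
    obtain ⟨p, hpd, hpe⟩ := mem_lowDegree.1 ((lowDegree n d).smul_mem (1 / 2) (hmem c))
    exact ⟨p, hpd, fun x => by rw [hpe]; simp; ring⟩
  choose p hpd hpe using hhalf
  have hq := subStochastic_fibreAvg hP
  refine hp ⟨p, Finset.sup_le fun c _ => hpd c, ⟨fun c x => ?_, fun x => ?_⟩, fun c x => ?_⟩
  · rw [hpe]
    linarith [hq.1 c x, hr.1 c x]
  · simp only [hpe, ← Finset.sum_div, Finset.sum_add_distrib]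
    linarith [hq.2 x, hr.2 x]
  · rw [hpe]
    linarith [hr.1 c x]

theorem sum_mul_sum_fibreAvg {n : ℕ} {A : Type*} [Fintype A] (f : QueryRel n A)
    (μ : Bits n → ℝ) (P : A → Matrix (Blocks n) (Blocks n) ℝ) :
    ∑ z with (f z).Nonempty, μ z * ∑ c ∈ f z, fibreAvg (P c) z
      = ∑ z : Blocks n × Blocks n with (liftRel f z.1 z.2).Nonempty,
          liftDist μ z * ∑ c ∈ liftRel f z.1 z.2, P c z.1 z.2 := by
  classical
  have hne : ∀ {T : Finset A} {a : ℝ} {g : A → ℝ}, a * ∑ c ∈ T, g c ≠ 0 → T.Nonempty := by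
    intro T a g h
    by_contra hT
    simp [Finset.not_nonempty_iff_eq_empty.1 hT] at h
  -- Inputs without an allowed output contribute an empty inner sum, so both filters can be dropped.
  rw [Finset.sum_filter_of_ne fun _ _ h => hne h, Finset.sum_filter_of_ne fun _ _ h => hne h,
    Fintype.sum_prod_type]
  have hl : ∀ z, μ z * ∑ c ∈ f z, fibreAvg (P c) z
      = ∑ c, (if c ∈ f z then μ z else 0) * fibreAvg (P c) z := by
    intro z
    simp [Finset.mul_sum, ite_mul, Finset.sum_ite_mem]
  have hr : ∀ x y, liftDist μ (x, y) * ∑ c ∈ liftRel f x y, P c x y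
      = ∑ c, (8 ^ n)⁻¹ * ((if c ∈ f (gadgetPow x y) then μ (gadgetPow x y) else 0) * P c x y) := by
    intro x y
    rw [← Finset.mul_sum, liftDist, pow_mul, mul_assoc]
    norm_num [Finset.mul_sum, ite_mul, Finset.sum_ite_mem, liftRel]
  simp only [hl, hr]
  rw [Finset.sum_comm]
  simp only [sum_mul_fibreAvg fun z => if _ ∈ f z then μ z else 0]
  simp only [Finset.mul_sum]
  rw [Finset.sum_comm]
  refine Finset.sum_congr rfl fun x _ => ?_
  rw [Finset.sum_comm]

theorem exists_le_gamma2_of_matApproxDist {n : ℕ} {A : Type*} [Fintype A] {f : QueryRel n A}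
    {μ : Bits n → ℝ} (hμ : ∀ z, 0 ≤ μ z) {δ : ℝ} (hD : 0 < adegDist f μ (1 - δ))
    {P : A → Matrix (Blocks n) (Blocks n) ℝ}
    (hP : MatApproxDist P (liftRel f) (liftDist μ) (1 - 2 * δ)) :
    ∃ c, √2 ^ adegDist f μ (1 - δ) / (2 * Fintype.card A) ≤ gamma2 (P c) := by
  rcases exists_le_gamma2_or_poly (adegDist f μ (1 - δ) - 1) hP.1 with h | ⟨p, hpd, hpb, hpe⟩
  · rwa [Nat.sub_add_cancel hD] at h
  -- The polynomials have degree at most one less than the approximate degree, so success `δ` would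
  -- contradict its minimality.
  · refine absurd ⟨p, ⟨hpb, ?_⟩, rfl⟩ (Nat.notMem_of_lt_sInf (hpd.trans_lt (Nat.sub_one_lt hD.ne')))
    have h := hP.2
    rw [← sum_mul_sum_fibreAvg] at h
    calc 1 - (1 - δ) ≤ (∑ z with (f z).Nonempty, μ z * ∑ c ∈ f z, fibreAvg (P c) z) / 2 := by
          linarith
      _ = ∑ z with (f z).Nonempty, μ z * ∑ c ∈ f z, fibreAvg (P c) z / 2 := by
          simp only [Finset.sum_div, mul_div_assoc]
      _ ≤ _ := Finset.sum_le_sum fun z _ =>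
          mul_le_mul_of_nonneg_left (Finset.sum_le_sum fun c _ => hpe c z) (hμ z)

theorem exists_le_gamma2_of_matApprox {n : ℕ} {A : Type*} [Fintype A] {f : QueryRel n A}
    {δ : ℝ} (hD : 0 < adeg f (1 - δ)) {P : A → Matrix (Blocks n) (Blocks n) ℝ}
    (hP : MatApprox P (liftRel f) (1 - 2 * δ)) :
    ∃ c, √2 ^ adeg f (1 - δ) / (2 * Fintype.card A) ≤ gamma2 (P c) := by
  rcases exists_le_gamma2_or_poly (adeg f (1 - δ) - 1) hP.1 with h | ⟨p, hpd, hpb, hpe⟩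
  · rwa [Nat.sub_add_cancel hD] at h
  · refine absurd ⟨p, ⟨hpb, fun z hz => ?_⟩, rfl⟩
      (Nat.notMem_of_lt_sInf (hpd.trans_lt (Nat.sub_one_lt hD.ne')))
    have h : 1 - (1 - 2 * δ) ≤ ∑ c ∈ f z, fibreAvg (P c) z := by
      rw [sum_fibreAvg]
      refine le_fibreAvg_of_le fun x y hxy => ?_
      have := hP.2 x y (by rwa [liftRel, hxy])
      rwa [liftRel, hxy, ← Matrix.sum_apply] at this
    calc 1 - (1 - δ) ≤ (∑ c ∈ f z, fibreAvg (P c) z) / 2 := by linarith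
      _ = ∑ c ∈ f z, fibreAvg (P c) z / 2 := Finset.sum_div _ _ _
      _ ≤ _ := Finset.sum_le_sum fun c _ => hpe c z

theorem ofReal_exp_le_systemGamma2 {X Y A : Type*} [Fintype A] {P : A → Matrix X Y ℝ} {t b : ℝ}
    (htb : Real.exp t ≤ b) (h : ∃ c, b ≤ gamma2 (P c)) :
    ENNReal.ofReal (Real.exp t) ≤ systemGamma2 P := by
  obtain ⟨c, hc⟩ := h
  exact (ENNReal.ofReal_le_ofReal (htb.trans hc)).trans
    (le_iSup (fun c => ENNReal.ofReal (gamma2 (P c))) c)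

theorem coe_le_log_of_ofReal_exp_le {t : ℝ} {a : ℝ≥0∞} (h : ENNReal.ofReal (Real.exp t) ≤ a) :
    (t : EReal) ≤ ENNReal.log a := by
  have := ENNReal.log_le_log h
  rwa [ENNReal.log_ofReal_of_pos (Real.exp_pos t), Real.log_exp] at this

/-! ### Counting certificates -/

/-- A certificate is determined by its set of (position, bit) pairs, a subset of a `2n`-element set
with at most `certCost S` elements. -/
theorem card_le_pow_certCost {n : ℕ} (S : Finset (PartialAssignment n)) :
    S.card ≤ (2 * n + 1) ^ certCost S := by
  classical
  set w := certCost S with hw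
  let graph : PartialAssignment n → Finset (Fin n × Bool) := fun c =>
    Finset.univ.filter fun p => c p.1 = some p.2
  have hinj : Function.Injective graph := by
    intro c c' h
    funext i
    refine Option.ext fun b => ?_
    simpa [graph] using Finset.ext_iff.1 h (i, b)
  have hsize : ∀ c, (graph c).card ≤ c.size := by
    intro c
    refine Finset.card_le_card_of_injOn Prod.fst ?_ ?_
    · rintro ⟨i, b⟩ hp
      simp_all [graph]
    · rintro ⟨i, b⟩ hp ⟨i', b'⟩ hp' h
      simp_all [graph]
  have hmaps : ∀ c ∈ S, graph c ∈ (Finset.range (w + 1)).biUnion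
      fun j => Finset.powersetCard j (Finset.univ : Finset (Fin n × Bool)) := by
    intro c hc
    have : c.size ≤ w := Finset.le_sup (f := fun c : PartialAssignment n => c.size) hc
    simpa using (Nat.lt_succ_of_le ((hsize c).trans this))
  calc S.card ≤ _ := Finset.card_le_card_of_injOn graph hmaps hinj.injOn
    _ ≤ ∑ j ∈ Finset.range (w + 1), (Finset.powersetCard j
          (Finset.univ : Finset (Fin n × Bool))).card := Finset.card_biUnion_le
    -- The factor `w.choose j ≥ 1` is inserted so that the sum becomes a binomial expansion.
    _ ≤ ∑ j ∈ Finset.range (w + 1), (2 * n) ^ j * 1 ^ (w - j) * w.choose j := by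
        refine Finset.sum_le_sum fun j hj => ?_
        rw [Finset.card_powersetCard, one_pow, mul_one]
        refine (Nat.choose_le_pow _ _).trans ?_
        have h1 : 0 < w.choose j := Nat.choose_pos (Nat.lt_succ_iff.1 (Finset.mem_range.1 hj))
        have h2 : (Finset.univ : Finset (Fin n × Bool)).card = 2 * n := by simp [mul_comm]
        rw [h2]
        exact Nat.le_mul_of_pos_right _ h1
    _ = (2 * n + 1) ^ w := (add_pow _ _ _).symm

theorem isLittleO_certCost_mul_log {n : ℕ → ℕ} {S : ∀ i, Finset (PartialAssignment (n i))}
    (hS : IsQueryTFNP n S) {D : ℕ → ℝ}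
    (hD : ∀ k : ℕ, (fun i => Real.log (n i) ^ k) =o[atTop] D) :
    (fun i => certCost (S i) * Real.log (2 * n i + 1)) =o[atTop] D := by
  obtain ⟨k, hk⟩ := hS.polylog_cert
  have hlog : (fun i => Real.log (2 * n i + 1)) =O[atTop] fun i => Real.log (n i) := by
    refine IsBigO.of_bound 2 ?_
    -- From 3 on, `2n + 1 ≤ n ^ 2`.
    filter_upwards [hS.strictMono.tendsto_atTop.eventually_ge_atTop 3] with i hi
    have h3 : (3 : ℝ) ≤ n i := by exact_mod_cast hi
    rw [Real.norm_of_nonneg (Real.log_nonneg (by linarith)),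
      Real.norm_of_nonneg (Real.log_nonneg (by linarith))]
    calc Real.log (2 * n i + 1) ≤ Real.log ((n i : ℝ) ^ 2) :=
          Real.log_le_log (by positivity) (by nlinarith)
      _ = 2 * Real.log (n i) := by rw [Real.log_pow]; norm_num
  refine (hk.mul hlog).trans_isLittleO ?_
  simpa only [pow_succ] using hD (k + 1)

theorem eventually_exp_le {n : ℕ → ℕ} {S : ∀ i, Finset (PartialAssignment (n i))}
    (hS : IsQueryTFNP n S) {D : ℕ → ℕ}
    (hD : ∀ k : ℕ, (fun i => Real.log (n i) ^ k) =o[atTop] fun i => (D i : ℝ)) :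
    ∀ᶠ i in atTop, 0 < D i ∧
      Real.exp (1 / 8 * D i) ≤ √2 ^ D i / (2 * Fintype.card (S i)) := by
  -- The exponent `k = 0` says that `D` tends to infinity; here it gives `D i ≥ 10`, enough for `exp
  -- (D i / 10)` to absorb the factor 2.
  have h0 := (hD 0).bound (by norm_num : (0 : ℝ) < 1 / 10)
  have h1 := (isLittleO_certCost_mul_log hS hD).bound (by norm_num : (0 : ℝ) < 1 / 10)
  filter_upwards [h0, h1] with i h0 h1
  simp only [pow_zero, norm_one, Real.norm_natCast] at h0 h1
  have hpos : 0 < D i := by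
    have : (0 : ℝ) < D i := by linarith
    exact_mod_cast this
  refine ⟨hpos, ?_⟩
  obtain ⟨c, -⟩ := hS.total i fun _ => false
  have hcard : (0 : ℝ) < Fintype.card (S i) := by
    exact_mod_cast Fintype.card_pos_iff.2 ⟨c⟩
  have h2 : (2 : ℝ) ≤ Real.exp (1 / 10 * D i) := by
    linarith [Real.add_one_le_exp (1 / 10 * (D i : ℝ))]
  have hle : (Fintype.card (S i) : ℝ) ≤ Real.exp (1 / 10 * D i) := by
    calc (Fintype.card (S i) : ℝ) ≤ (2 * n i + 1) ^ certCost (S i) := by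
          rw [Fintype.card_coe]
          exact_mod_cast card_le_pow_certCost (S i)
      _ = Real.exp (certCost (S i) * Real.log (2 * n i + 1)) := by
          rw [← Real.log_pow, Real.exp_log (by positivity)]
      _ ≤ _ := Real.exp_le_exp.2 ((le_abs_self _).trans h1)
  have hsqrt : √2 ^ D i = Real.exp (D i * (Real.log 2 / 2)) := by
    rw [← Real.log_sqrt (by norm_num), ← Real.log_pow, Real.exp_log (by positivity)]
  rw [le_div_iff₀ (by positivity), hsqrt]
  -- One factor `exp (D i / 10)` pays for the 2 and one for the number of certificates; `1/8 + 1/10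
  -- + 1/10 = 0.325` stays below `log 2 / 2 ≈ 0.3466`.
  calc Real.exp (1 / 8 * D i) * (2 * Fintype.card (S i))
      ≤ Real.exp (1 / 8 * D i) * (Real.exp (1 / 10 * D i) * Real.exp (1 / 10 * D i)) := by
        gcongr
    _ = Real.exp ((1 / 8 + 1 / 10 + 1 / 10) * D i) := by
        rw [← Real.exp_add, ← Real.exp_add]
        ring_nf
    _ ≤ _ := by
        rw [mul_comm]
        gcongr
        linarith [Real.log_two_gt_d9]

end TotalSearch

theorem mainTheorem5 :
    (∀ (n : ℕ) (μ : Bits n → ℝ), μ ∈ stdSimplex ℝ (Bits n) →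
      liftDist μ ∈ stdSimplex ℝ (Blocks n × Blocks n)) ∧
    ∃ C : ℝ, 0 < C ∧
      (∀ (n : ℕ → ℕ) (S : ∀ i, Finset (PartialAssignment (n i))) (μ : ∀ i, Bits (n i) → ℝ)
          (δ : ℕ → ℝ),
        IsQueryTFNP n S →
        (∀ i, μ i ∈ stdSimplex ℝ (Bits (n i))) →
        (∀ i, 0 < δ i ∧ δ i ≤ 1) →
        (∀ k : ℕ, (fun i => Real.log (n i) ^ k) =o[atTop]
          fun i => (adegDist (searchRel (S i)) (μ i) (1 - δ i) : ℝ)) →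
        (∀ i, (2 : ℝ) ^ (-(adeg (searchRel (S i)) (1 - δ i) : ℝ) / 3) < δ i) →
        ∀ᶠ i in atTop,
          ((C * (adegDist (searchRel (S i)) (μ i) (1 - δ i) : ℝ) : ℝ) : EReal) ≤
            ENNReal.log
              (agamma2Dist (liftRel (searchRel (S i))) (liftDist (μ i)) (1 - 2 * δ i))) ∧
      (∀ (n : ℕ → ℕ) (S : ∀ i, Finset (PartialAssignment (n i))) (δ : ℕ → ℝ),
        IsQueryTFNP n S →
        (∀ i, 0 < δ i ∧ δ i ≤ 1) →
        (∀ k : ℕ, (fun i => Real.log (n i) ^ k) =o[atTop]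
          fun i => (adeg (searchRel (S i)) (1 - δ i) : ℝ)) →
        (∀ i, (2 : ℝ) ^ (-(adeg (searchRel (S i)) (1 - δ i) : ℝ) / 3) < δ i) →
        ∀ᶠ i in atTop,
          ((C * (adeg (searchRel (S i)) (1 - δ i) : ℝ) : ℝ) : EReal) ≤
            ENNReal.log (agamma2 (liftRel (searchRel (S i))) (1 - 2 * δ i))) := by
  refine ⟨fun n μ hμ => liftDist_mem_stdSimplex hμ, 1 / 8, by norm_num, ?_, ?_⟩
  · intro n S μ δ hS hμ _ hD _
    filter_upwards [eventually_exp_le hS hD] with i ⟨hpos, hexp⟩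
    refine coe_le_log_of_ofReal_exp_le (le_iInf₂ fun P hP => ?_)
    exact ofReal_exp_le_systemGamma2 hexp
      (exists_le_gamma2_of_matApproxDist (hμ i).1 hpos hP)
  · intro n S δ hS _ hD _
    filter_upwards [eventually_exp_le hS hD] with i ⟨hpos, hexp⟩
    refine coe_le_log_of_ofReal_exp_le (le_iInf₂ fun P hP => ?_)
    exact ofReal_exp_le_systemGamma2 hexp (exists_le_gamma2_of_matApprox hpos hP)
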